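/- Let $\psi=\Gamma'/\Gamma$ be the digamma function, $G=\sum_{k\ge 0}\frac{(-1)^k}{(2k+1)^2}$ Catalan's constant, and $\mathrm{Li}_3(z)$ the trilogarithm, i.e. the analytic continuation to $\mathbb{C}\setminus[1,\infty)$ of $\sum_{k\ge1} z^k/k^3$ ($|z|<1$). Let $m$ and $n$ be positive integers with $n\ge m$, let $d=n-m$, $L=\Im\,\mathrm{Li}_3(1+i)$, and $$\Theta_2(n,2m+1)=\sum_{k=1}^\infty (-1)^k\,\frac{\psi\left(\frac{2k+2n+5}{4}\right)-\psi\left(\frac{2k+2n+3}{4}\right)}{(2k+2m+1)^2}.$$ This series converges absolutely, and its value is as follows (empty sums are $0$). If $n=m$: $$\Theta_2(n,2m+1)=(-1)^m\left(-4-4\sum_{k=1}^m\sum_{j=0}^k\frac{(-1)^j}{(2j+1)(2k+1)^2}+\left(1-\frac{\ln^2 2}{4}+\sum_{k=1}^m\frac1{(2k+1)^2}\right)\pi-\frac{\pi^3}{8}+4L\right).$$ If $n=m+1$: $$\Theta_2(n,2m+1)=(-1)^m\left(\frac{11}{3}+4\sum_{k=1}^m\sum_{j=0}^{k+1}\frac{(-1)^j}{(2j+1)(2k+1)^2}-\frac{3\pi}{2}+\left(\frac{\ln^2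 2}{4}-\sum_{k=1}^m\frac{1}{(2k+1)^2}\right)\pi+\frac{\pi^3}{8}+2G-4L\right).$$ If $d$ is odd and $d\ne1$: $$\begin{aligned}\Theta_2(n,2m+1)=(-1)^m\Bigg(&5-\sum_{j=1}^{\frac{d-1}{2}}\frac1{4j^2(4j+1)}-4\sum_{k=1}^m\sum_{j=0}^{k+d}\frac{(-1)^{j+d}}{(2j+1)(2k+1)^2}+\frac14\sum_{k=1}^{\frac{d-1}{2}}\sum_{j=0}^{2k}\frac{(-1)^j(8k^2+4k+1)}{k^2(2j+1)(2k+1)^2}\\&+4\sum_{j=1}^{d}\frac{(-1)^j}{2j+1}+\left(2-\sum_{j=1}^{\frac{d-1}{2}}\frac1{j(2j+1)}\right)G\\&+\left(\frac{\ln^2 2}{4}-\frac32+(-1)^d\sum_{j=1}^m\frac1{(2j+1)^2}-\frac12\sum_{j=1}^{\frac{d-1}{2}}\frac1{(2j+1)^2}\right)\pi+\frac{\pi^3}{8}-4L\Bigg).\end{aligned}$$ If $d$ is even: $$\begin{aligned}\Theta_2(n,2m+1)=(-1)^m\Bigg(&-4+\frac14\sum_{j=1}^{\frac d2}\frac1{j^2(4j-1)}-4\sum_{k=1}^m\sum_{j=0}^{k+d}\frac{(-1)^{j+d}}{(2j+1)(2k+1)^2}-\frac14\sum_{k=1}^{\frac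 d2}\sum_{j=0}^{2k-2}\frac{(-1)^j(8k^2-4k+1)}{k^2(2j+1)(2k-1)^2}\\&-4\sum_{j=1}^{d}\frac{(-1)^j}{2j+1}+\left(1+(-1)^d\sum_{j=1}^m\frac1{(2j+1)^2}+\frac12\sum_{j=1}^{\frac d2}\frac1{(2j-1)^2}\right)\pi\\&-\frac{\pi}{4}\ln^2 2-\frac{\pi^3}{8}-G\sum_{j=1}^{\frac d2}\frac1{j(2j-1)}+4L\Bigg).\end{aligned}$$ -/

import Mathlib

open Complex MeasureTheory Set

/-- The polylogarithm `Li_s(z) = z / Γ(s) * ∫₀^∞ x^(s-1) / (e^x - z) dx` for `Re s > 0` and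
`z` in the plane cut along `[1, ∞)`. The two lemmas below show that this is the sum of
`z ^ k / k ^ s` on the closed unit disc when `Re s > 1`, and that it is holomorphic on the cut
plane, so that it is the principal branch of the analytic continuation of that power series. -/
noncomputable def polylog (s z : ℂ) : ℂ :=
  z / Complex.Gamma s * ∫ x in Ioi (0 : ℝ), (x : ℂ) ^ (s - 1) / (Complex.exp x - z)

theorem hasSum_polylog {s z : ℂ} (hs : 1 < s.re) (hz : ‖z‖ ≤ 1) :
    HasSum (fun k : ℕ => z ^ (k + 1) / ((k : ℂ) + 1) ^ s) (polylog s z) := by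
  have hs0 : 0 < s.re := by linarith
  have hG : Complex.Gamma s ≠ 0 := Complex.Gamma_ne_zero_of_re_pos hs0
  have key := hasSum_mellin (a := fun k : ℕ => z ^ (k + 1)) (p := fun k : ℕ => (k : ℝ) + 1)
    (F := fun t : ℝ => z / (Complex.exp t - z)) (s := s)
    (fun k => Or.inr (by positivity)) hs0
    (by
      intro t ht
      have ht' : (0 : ℝ) < t := ht
      have hlt : ‖z * Complex.exp (-t)‖ < 1 := by
        rw [norm_mul, Complex.norm_exp]
        have h1 : Real.exp ((-(t : ℂ)).re) < 1 := by
          simpa using ht'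
        have h2 : 0 < Real.exp ((-(t : ℂ)).re) := Real.exp_pos _
        nlinarith [norm_nonneg z]
      have h := (hasSum_geometric_of_norm_lt_one hlt).mul_left (z * Complex.exp (-t))
      have he : Complex.exp t ≠ 0 := Complex.exp_ne_zero _
      have hne : (1 : ℂ) - z * Complex.exp (-t) ≠ 0 := by
        intro h0
        have : z * Complex.exp (-t) = 1 := by linear_combination -h0
        rw [this] at hlt
        simp at hlt
      have e1 : ∀ k : ℕ, z ^ (k + 1) * ((Real.exp (-((k : ℝ) + 1) * t) : ℝ) : ℂ) =
          z * Complex.exp (-t) * (z * Complex.exp (-t)) ^ k := by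
        intro k
        have e2 : Complex.exp (-t) ^ (k + 1) = Complex.exp (-((k : ℂ) + 1) * t) := by
          rw [← Complex.exp_nat_mul]
          congr 1
          push_cast
          ring
        push_cast
        rw [← e2, ← pow_succ', mul_pow]
      have e3 : z / (Complex.exp t - z) =
          z * Complex.exp (-t) * (1 - z * Complex.exp (-t))⁻¹ := by
        rw [Complex.exp_neg] at hne ⊢
        have hne' : Complex.exp t - z ≠ 0 := by
          intro h0
          apply hne
          have : z = Complex.exp t := by linear_combination -h0
          rw [this]
          field_simp
          ring
        field_simp
      simp only [e1, e3]
      exact h)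
    (by
      have h := (Real.summable_one_div_nat_add_rpow 1 s.re).2 hs
      refine Summable.of_nonneg_of_le (fun k => by positivity) (fun k => ?_) h
      rw [abs_of_nonneg (by positivity : (0 : ℝ) ≤ (k : ℝ) + 1)]
      gcongr
      simpa using pow_le_one₀ (norm_nonneg z) hz)
  have h2 := key.mul_left (Complex.Gamma s)⁻¹
  have e4 : ∀ k : ℕ, (Complex.Gamma s)⁻¹ *
      (Complex.Gamma s * z ^ (k + 1) / (((k : ℝ) + 1 : ℝ) : ℂ) ^ s) =
      z ^ (k + 1) / ((k : ℂ) + 1) ^ s := by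
    intro k
    push_cast
    field_simp
  have e5 : (Complex.Gamma s)⁻¹ * mellin (fun t : ℝ => z / (Complex.exp t - z)) s =
      polylog s z := by
    have e6 : ∀ x : ℝ, (x : ℂ) ^ (s - 1) • (z / (Complex.exp x - z)) =
        z * ((x : ℂ) ^ (s - 1) / (Complex.exp x - z)) := by
      intro x
      rw [smul_eq_mul]
      ring
    unfold polylog mellin
    simp only [e6]
    rw [integral_const_mul]
    ring
  rw [← e5]
  simpa only [e4] using h2

theorem differentiableOn_polylog {s : ℂ} (hs : 0 < s.re) :
    DifferentiableOn ℂ (polylog s) {z : ℂ | ¬ (z.im = 0 ∧ 1 ≤ z.re)} := by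
  have hopen : IsOpen {z : ℂ | ¬ (z.im = 0 ∧ 1 ≤ z.re)} := by
    have : IsClosed {z : ℂ | z.im = 0 ∧ 1 ≤ z.re} :=
      (isClosed_eq Complex.continuous_im continuous_const).inter
        (isClosed_le continuous_const Complex.continuous_re)
    exact this.isOpen_compl
  intro z₀ hz₀
  apply DifferentiableAt.differentiableWithinAt
  obtain ⟨ε, hε, hball⟩ := Metric.nhds_basis_closedBall.mem_iff.1 (hopen.mem_nhds hz₀)
  have hcpt : IsCompact (Metric.closedBall z₀ ε ×ˢ Icc (0 : ℝ) 1) :=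
    (isCompact_closedBall z₀ ε).prod isCompact_Icc
  have hnz : ∀ p ∈ Metric.closedBall z₀ ε ×ˢ Icc (0 : ℝ) 1, (1 : ℂ) - p.1 * p.2 ≠ 0 := by
    rintro ⟨z, t⟩ ⟨hz, ht0, ht1⟩ h0
    apply hball hz
    have h1 : z.re * t = 1 := by
      have := congrArg Complex.re h0
      simp at this
      linarith
    have h2 : z.im * t = 0 := by
      have := congrArg Complex.im h0
      simpa using this
    have ht : t ≠ 0 := by
      rintro rfl
      simp at h1
    refine ⟨by simpa [ht] using h2, ?_⟩
    simp only at ht0 ht1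
    have : 0 < t := lt_of_le_of_ne ht0 (Ne.symm ht)
    nlinarith
  obtain ⟨p, hp, hmin⟩ := hcpt.exists_isMinOn
    ⟨(z₀, 0), by simp [hε.le]⟩
    (f := fun p : ℂ × ℝ => ‖(1 : ℂ) - p.1 * p.2‖) (by fun_prop)
  set c := ‖(1 : ℂ) - p.1 * p.2‖ with hc
  have hcpos : 0 < c := norm_pos_iff.2 (hnz p hp)
  have hlow : ∀ z ∈ Metric.closedBall z₀ ε, ∀ x ∈ Ioi (0 : ℝ),
      c * Real.exp x ≤ ‖Complex.exp x - z‖ := by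
    intro z hz x hx
    have hx' : (0 : ℝ) < x := hx
    have h := hmin (show ((z, Real.exp (-x)) : ℂ × ℝ) ∈ _ from
      ⟨hz, (Real.exp_pos _).le, by simpa using hx'.le⟩)
    have h' : c ≤ ‖(1 : ℂ) - z * ((Real.exp (-x) : ℝ) : ℂ)‖ := h
    have heq : Complex.exp x - z =
        ((Real.exp x : ℝ) : ℂ) * ((1 : ℂ) - z * ((Real.exp (-x) : ℝ) : ℂ)) := by
      have : ((Real.exp x : ℝ) : ℂ) * ((Real.exp (-x) : ℝ) : ℂ) = 1 := by
        rw [← Complex.ofReal_mul, ← Real.exp_add]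
        simp
      rw [← Complex.ofReal_exp]
      linear_combination z * this
    rw [heq, norm_mul, Complex.norm_real, Real.norm_of_nonneg (Real.exp_pos _).le, mul_comm]
    gcongr
  have hmeas : ∀ z : ℂ, AEStronglyMeasurable
      (fun x : ℝ => (x : ℂ) ^ (s - 1) / (Complex.exp x - z)) (volume.restrict (Ioi 0)) := by
    intro z
    apply Measurable.aestronglyMeasurable
    fun_prop
  have hnorm : ∀ x ∈ Ioi (0 : ℝ), ‖(x : ℂ) ^ (s - 1)‖ = x ^ (s.re - 1) := by
    intro x hx
    rw [Complex.norm_cpow_eq_rpow_re_of_pos hx]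
    simp
  have hGam : IntegrableOn (fun x : ℝ => Real.exp (-x) * x ^ (s.re - 1)) (Ioi 0) :=
    Real.GammaIntegral_convergent hs
  have hint : Integrable
      (fun x : ℝ => (x : ℂ) ^ (s - 1) / (Complex.exp x - z₀)) (volume.restrict (Ioi 0)) := by
    refine (hGam.const_mul c⁻¹).mono' (hmeas z₀) ?_
    refine (ae_restrict_iff' measurableSet_Ioi).2 (Filter.Eventually.of_forall fun x hx => ?_)
    have h := hlow z₀ (Metric.mem_closedBall_self hε.le) x hx
    rw [norm_div, hnorm x hx]
    have hx' : (0 : ℝ) < x := hx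
    have e : c⁻¹ * (Real.exp (-x) * x ^ (s.re - 1)) = x ^ (s.re - 1) / (c * Real.exp x) := by
      rw [Real.exp_neg]
      field_simp
    rw [e]
    gcongr
  have hd := hasDerivAt_integral_of_dominated_loc_of_deriv_le
    (μ := volume.restrict (Ioi (0 : ℝ)))
    (F := fun (z : ℂ) (x : ℝ) => (x : ℂ) ^ (s - 1) / (Complex.exp x - z))
    (F' := fun (z : ℂ) (x : ℝ) => (x : ℂ) ^ (s - 1) / (Complex.exp x - z) ^ 2)
    (x₀ := z₀) (bound := fun x : ℝ => (c ^ 2)⁻¹ * (Real.exp (-x) * x ^ (s.re - 1)))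
    (Metric.closedBall_mem_nhds z₀ hε)
    (Filter.Eventually.of_forall hmeas) hint
    (by
      apply Measurable.aestronglyMeasurable
      fun_prop)
    (by
      refine (ae_restrict_iff' measurableSet_Ioi).2 (Filter.Eventually.of_forall fun x hx => ?_)
      intro z hz
      have h := hlow z hz x hx
      have hx' : (0 : ℝ) < x := hx
      rw [norm_div, hnorm x hx, norm_pow]
      have e : (c ^ 2)⁻¹ * (Real.exp (-x) * x ^ (s.re - 1)) =
          x ^ (s.re - 1) / (c ^ 2 * Real.exp x) := by
        rw [Real.exp_neg]
        field_simp
      rw [e]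
      have h1 : 1 ≤ Real.exp x := Real.one_le_exp hx'.le
      have h2 : c ^ 2 * Real.exp x ≤ ‖Complex.exp x - z‖ ^ 2 := by
        calc c ^ 2 * Real.exp x ≤ (c * Real.exp x) ^ 2 := by
              rw [mul_pow]
              gcongr
              nlinarith
          _ ≤ _ := by gcongr
      gcongr)
    (hGam.const_mul _)
    (by
      refine (ae_restrict_iff' measurableSet_Ioi).2 (Filter.Eventually.of_forall fun x hx => ?_)
      intro z hz
      have h := hlow z hz x hx
      have hne : Complex.exp x - z ≠ 0 := by
        rw [← norm_pos_iff]
        exact lt_of_lt_of_le (mul_pos hcpos (Real.exp_pos x)) h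
      have h1 : HasDerivAt (fun w : ℂ => Complex.exp x - w) (-1) z := by
        simpa using (hasDerivAt_id z).const_sub (Complex.exp x)
      have h2 := (hasDerivAt_const z ((x : ℂ) ^ (s - 1))).div h1 hne
      have e : (0 * (Complex.exp x - z) - (x : ℂ) ^ (s - 1) * (-1)) / (Complex.exp x - z) ^ 2 =
          (x : ℂ) ^ (s - 1) / (Complex.exp x - z) ^ 2 := by ring
      rw [e] at h2
      exact h2)
  exact (differentiableAt_id.div_const _).mul hd.2.differentiableAt

/-- Catalan's constant. -/
noncomputable def catalanConstant : ℝ := ∑' k : ℕ, (-1 : ℝ) ^ k / (2 * (k : ℝ) + 1) ^ 2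

/-- The difference of digamma values `ψ((2k+2n+5)/4) - ψ((2k+2n+3)/4)`. -/
noncomputable def digammaDiff (k n : ℕ) : ℂ :=
  Complex.digamma ((2 * (k : ℂ) + 2 * n + 5) / 4) - Complex.digamma ((2 * (k : ℂ) + 2 * n + 3) / 4)

/-- The `k`-th term of the series `Θ₂(n, α)`, which is summed over `k ≥ 1`. -/
noncomputable def theta2Term (n α k : ℕ) : ℂ :=
  (-1) ^ k * (digammaDiff k n / (2 * (k : ℂ) + α) ^ 2)

/-! Write R_N for the Leibniz tail and S_d = Σ_{l≥0} R_{l+d+1}/(2l+1)². The reflection formula and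
the recurrence for ψ turn the digamma difference into ±4 R_{k+n+1}, with a sign that absorbs (-1)^k.
With n = m+d and l = k+m, the series Θ₂ becomes 4(-1)^{m+d+1} times the part l > m of S_d
(`digamma_sub_eq_leibnizTail`, `hasSum_theta2Term`). The removed terms with 1 ≤ l ≤ m produce the
sums over k ≤ m, so it remains to evaluate S_d.

The dependence on d is elementary: R_N - R_{N+1} is a single fraction, and partial fractions express
S_d - S_{d+1} by Catalan's constant, π and R_{d+1} (`leibnizTailSum_succ`). Iterating two steps at a
time gives `thetaConst_even` and `thetaConst_odd`.

The trilogarithm enters through S_0. Since R_N = (-1)^N ∫₀¹ x^{2N}/(1+x²) dx, summation under the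
integral gives S_0 = -∫₀¹ x Im Li₂(ix)/(1+x²) dx. The integrand has an explicit primitive built from
Li₃, Li₂ and logarithms at 1+ix (`hasDerivAt_landenPrimitive`). Its value at 1 follows from the
dilogarithm reflection formula, and its limit at 0 is 0. -/

/-! ### Digamma differences as Leibniz tails. -/

/-- The tail `π/4 - ∑_{j<N} (-1)^j/(2j+1)` of the Leibniz series. -/
noncomputable def leibnizTail (N : ℕ) : ℝ :=
  Real.pi / 4 - ∑ j ∈ Finset.range N, (-1 : ℝ) ^ j / (2 * (j : ℝ) + 1)

theorem leibnizTail_zero : leibnizTail 0 = Real.pi / 4 := by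
  simp [leibnizTail]

theorem leibnizTail_succ (N : ℕ) :
    leibnizTail (N + 1) = leibnizTail N - (-1 : ℝ) ^ N / (2 * (N : ℝ) + 1) := by
  simp only [leibnizTail, Finset.sum_range_succ]
  ring

/-- Logarithmic derivative of Γ(s)Γ(1-s) = π / sin πs. -/
theorem digamma_sub_digamma_one_sub {s : ℂ} (hs : ∀ m : ℕ, s ≠ -m) (hs' : ∀ m : ℕ, 1 - s ≠ -m)
    (hsin : Complex.sin (Real.pi * s) ≠ 0) :
    digamma s - digamma (1 - s) =
      -Real.pi * Complex.cos (Real.pi * s) / Complex.sin (Real.pi * s) := by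
  have hd := (Complex.differentiableAt_Gamma s hs).hasDerivAt
  have hd' := (Complex.differentiableAt_Gamma (1 - s) hs').hasDerivAt
  have h1 : HasDerivAt (fun w : ℂ => Complex.Gamma w * Complex.Gamma (1 - w))
      (deriv Complex.Gamma s * Complex.Gamma (1 - s) +
        Complex.Gamma s * (deriv Complex.Gamma (1 - s) * (-1))) s := by
    refine hd.mul ?_
    have h : HasDerivAt (fun w : ℂ => 1 - w) (-1) s := by
      simpa using (hasDerivAt_id s).const_sub 1
    exact hd'.comp s h
  have h2 : HasDerivAt (fun w : ℂ => (Real.pi : ℂ) / Complex.sin (Real.pi * w))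
      ((0 * Complex.sin (Real.pi * s) - Real.pi * (Complex.cos (Real.pi * s) * Real.pi)) /
        Complex.sin (Real.pi * s) ^ 2) s := by
    refine (hasDerivAt_const s (Real.pi : ℂ)).div ?_ hsin
    have h : HasDerivAt (fun w : ℂ => (Real.pi : ℂ) * w) Real.pi s := by
      simpa using (hasDerivAt_id s).const_mul (Real.pi : ℂ)
    exact h.csin
  have h3 : (fun w : ℂ => Complex.Gamma w * Complex.Gamma (1 - w)) =
      fun w : ℂ => (Real.pi : ℂ) / Complex.sin (Real.pi * w) := by
    funext w
    exact Complex.Gamma_mul_Gamma_one_sub w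
  rw [h3] at h1
  have h4 := h1.unique h2
  have hG := Complex.Gamma_ne_zero hs
  have hG' := Complex.Gamma_ne_zero hs'
  have hp := Complex.Gamma_mul_Gamma_one_sub s
  have hpi : (Real.pi : ℂ) ≠ 0 := by exact_mod_cast Real.pi_ne_zero
  rw [Complex.digamma_def, logDeriv_apply, logDeriv_apply]
  have h5 : deriv Complex.Gamma s / Complex.Gamma s -
      deriv Complex.Gamma (1 - s) / Complex.Gamma (1 - s) =
      (deriv Complex.Gamma s * Complex.Gamma (1 - s) +
        Complex.Gamma s * (deriv Complex.Gamma (1 - s) * (-1))) /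
        (Complex.Gamma s * Complex.Gamma (1 - s)) := by
    field_simp
    ring
  rw [h5, h4, hp]
  field_simp
  ring

theorem digamma_one_quarter_sub :
    digamma (1 / 4) - digamma (3 / 4) = -(Real.pi : ℂ) := by
  have key : (Real.pi : ℂ) * (1 / 4) = ((Real.pi / 4 : ℝ) : ℂ) := by push_cast; ring
  have hsin : Complex.sin (Real.pi * (1 / 4)) ≠ 0 := by
    rw [key, ← Complex.ofReal_sin, Real.sin_pi_div_four]
    exact_mod_cast (by positivity : Real.sqrt 2 / 2 ≠ 0)
  have hre : ∀ (x : ℝ), 0 < x → ∀ m : ℕ, (x : ℂ) ≠ -(m : ℂ) := by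
    intro x hx m h
    have := congrArg Complex.re h
    simp at this
    have hm : (0 : ℝ) ≤ m := m.cast_nonneg
    linarith
  have h := digamma_sub_digamma_one_sub (s := 1 / 4)
    (by simpa using hre (1 / 4) (by norm_num))
    (by
      have := hre (3 / 4) (by norm_num)
      intro m
      convert this m using 1
      push_cast
      norm_num) hsin
  rw [show (1 : ℂ) - 1 / 4 = 3 / 4 by norm_num] at h
  rw [h, mul_div_assoc, key, ← Complex.ofReal_cos, ← Complex.ofReal_sin, Real.sin_pi_div_four,
    Real.cos_pi_div_four, div_self, mul_one]
  exact_mod_cast (by positivity : Real.sqrt 2 / 2 ≠ 0)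

/-- Passing from N to N+1, the old upper argument becomes the lower one, and the new upper argument
is the old lower one plus 1. The difference therefore changes sign and gains 4/(2N+3), which is the
recursion of the tail. The case N = 0 comes from ψ(1/4) - ψ(3/4) = -π. -/
theorem digamma_sub_eq_leibnizTail (N : ℕ) :
    digamma ((2 * (N : ℂ) + 5) / 4) - digamma ((2 * (N : ℂ) + 3) / 4) =
      ((4 * (-1) ^ (N + 1) * leibnizTail (N + 1) : ℝ) : ℂ) := by
  have hrec : ∀ x : ℝ, 0 < x → digamma ((x : ℂ) + 1) = digamma x + (x : ℂ)⁻¹ := by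
    intro x hx
    refine Complex.digamma_apply_add_one _ fun m h => ?_
    have := congrArg Complex.re h
    simp at this
    have hm : (0 : ℝ) ≤ m := m.cast_nonneg
    linarith
  induction N with
  | zero =>
    have h := hrec (1 / 4) (by norm_num)
    have h2 := digamma_one_quarter_sub
    rw [show (((1 / 4 : ℝ) : ℂ)) + 1 = 5 / 4 by push_cast; norm_num] at h
    rw [show (((1 / 4 : ℝ) : ℂ)) = 1 / 4 by push_cast; norm_num] at h
    simp only [leibnizTail_succ, leibnizTail_zero]
    push_cast
    rw [show ((2 * (0 : ℂ) + 5) / 4) = 5 / 4 by norm_num,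
      show ((2 * (0 : ℂ) + 3) / 4) = 3 / 4 by norm_num, h]
    norm_num
    linear_combination h2
  | succ N ih =>
    have h := hrec ((2 * N + 3) / 4) (by positivity)
    have hne : (2 * (N : ℂ) + 3) ≠ 0 := by
      exact_mod_cast (by positivity : (2 * N + 3 : ℕ) ≠ 0)
    rw [show ((((2 * N + 3) / 4 : ℝ) : ℂ)) + 1 = (2 * (N + 1 : ℕ) + 5) / 4 by
        push_cast; ring,
      show ((((2 * N + 3) / 4 : ℝ) : ℂ)) = (2 * (N : ℂ) + 3) / 4 by push_cast; ring] at h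
    rw [h, show (2 * ((N + 1 : ℕ) : ℂ) + 3) / 4 = (2 * N + 5) / 4 by push_cast; ring,
      leibnizTail_succ (N + 1)]
    have hs : ((-1 : ℝ) ^ (N + 1)) * (-1) ^ (N + 1) = 1 := by
      rw [← mul_pow]; simp
    have e : (4 * (-1 : ℝ) ^ (N + 1 + 1) *
        (leibnizTail (N + 1) - (-1) ^ (N + 1) / (2 * ((N + 1 : ℕ) : ℝ) + 1))) =
        -(4 * (-1) ^ (N + 1) * leibnizTail (N + 1)) + 4 / (2 * N + 3) := by
      rw [show 2 * ((N + 1 : ℕ) : ℝ) + 1 = 2 * N + 3 by push_cast; ring]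
      linear_combination (4 / (2 * (N : ℝ) + 3)) * hs
    rw [e, Complex.ofReal_add, Complex.ofReal_neg, ← ih]
    push_cast
    field_simp
    ring

theorem theta2Term_eq_leibnizTail (n α k : ℕ) :
    theta2Term n α k =
      ((4 * (-1) ^ (n + 1) * (leibnizTail (k + n + 1) / (2 * (k : ℝ) + α) ^ 2) : ℝ) : ℂ) := by
  have h := digamma_sub_eq_leibnizTail (k + n)
  have hs : ((-1 : ℂ) ^ k) * (-1) ^ k = 1 := by
    rw [← mul_pow]; simp
  unfold theta2Term digammaDiff
  rw [show (2 * (k : ℂ) + 2 * n + 5) = 2 * ((k + n : ℕ) : ℂ) + 5 by push_cast; ring,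
    show (2 * (k : ℂ) + 2 * n + 3) = 2 * ((k + n : ℕ) : ℂ) + 3 by push_cast; ring, h]
  push_cast
  linear_combination (4 * (-1 : ℂ) ^ (n + 1) * (leibnizTail (k + n + 1) /
    (2 * (k : ℂ) + α) ^ 2)) * hs

/-! ### Leibniz tails: integral form, summability, recursion in d. -/

theorem leibnizTail_eq_integral (N : ℕ) :
    leibnizTail N = (-1) ^ N * ∫ x in (0 : ℝ)..1, x ^ (2 * N) / (1 + x ^ 2) := by
  have hcont : ∀ N : ℕ, Continuous fun x : ℝ => x ^ (2 * N) / (1 + x ^ 2) := fun N =>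
    (by fun_prop : Continuous fun x : ℝ => x ^ (2 * N)).div (by fun_prop) fun x => by positivity
  induction N with
  | zero =>
    simp [leibnizTail_zero]
  | succ N ih =>
    have h : (∫ x in (0 : ℝ)..1, x ^ (2 * N) / (1 + x ^ 2)) +
        ∫ x in (0 : ℝ)..1, x ^ (2 * (N + 1)) / (1 + x ^ 2) = 1 / (2 * (N : ℝ) + 1) := by
      rw [← intervalIntegral.integral_add ((hcont _).intervalIntegrable _ _)
        ((hcont _).intervalIntegrable _ _)]
      have e : ∀ x : ℝ, x ^ (2 * N) / (1 + x ^ 2) + x ^ (2 * (N + 1)) / (1 + x ^ 2) =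
          x ^ (2 * N) := by
        intro x
        have : 1 + x ^ 2 ≠ 0 := by positivity
        field_simp
        ring
      simp only [e, integral_pow]
      push_cast
      simp
    rw [leibnizTail_succ, ih, pow_succ]
    linear_combination ((-1 : ℝ) ^ N) * h

theorem abs_leibnizTail_le (N : ℕ) : |leibnizTail N| ≤ 1 / (2 * (N : ℝ) + 1) := by
  have hcont : Continuous fun x : ℝ => x ^ (2 * N) / (1 + x ^ 2) :=
    (by fun_prop : Continuous fun x : ℝ => x ^ (2 * N)).div (by fun_prop) fun x => by positivity
  rw [leibnizTail_eq_integral, abs_mul, abs_pow, abs_neg, abs_one, one_pow, one_mul,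
    abs_of_nonneg (intervalIntegral.integral_nonneg zero_le_one fun x hx =>
      div_nonneg (pow_nonneg hx.1 _) (by positivity))]
  calc _ ≤ ∫ x in (0 : ℝ)..1, x ^ (2 * N) := by
        refine intervalIntegral.integral_mono_on zero_le_one (hcont.intervalIntegrable _ _)
          ((by fun_prop : Continuous fun x : ℝ => x ^ (2 * N)).intervalIntegrable _ _)
          fun x hx => ?_
        exact div_le_self (pow_nonneg hx.1 _) (by nlinarith [sq_nonneg x])
    _ = _ := by
        simp

theorem summable_one_div_odd_sq : Summable fun l : ℕ => 1 / (2 * (l : ℝ) + 1) ^ 2 := by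
  have h : Summable fun l : ℕ => 1 / ((l : ℝ) + 1) ^ 2 := by
    exact_mod_cast (summable_nat_add_iff 1).2 (Real.summable_one_div_nat_pow.2 one_lt_two)
  refine Summable.of_nonneg_of_le (fun l => by positivity) (fun l => ?_) h
  have hl : (0 : ℝ) ≤ l := l.cast_nonneg
  gcongr
  linarith

theorem hasSum_catalanConstant :
    HasSum (fun k : ℕ => (-1 : ℝ) ^ k / (2 * (k : ℝ) + 1) ^ 2) catalanConstant := by
  refine Summable.hasSum (Summable.of_norm_bounded summable_one_div_odd_sq fun l => ?_)
  simp

theorem summable_leibnizTail (d : ℕ) :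
    Summable fun l : ℕ => leibnizTail (l + d + 1) / (2 * (l : ℝ) + 1) ^ 2 := by
  refine Summable.of_norm_bounded summable_one_div_odd_sq fun l => ?_
  rw [norm_div, Real.norm_eq_abs, Real.norm_of_nonneg (by positivity)]
  gcongr
  refine (abs_leibnizTail_le _).trans ?_
  rw [div_le_one (by positivity)]
  have : (0 : ℝ) ≤ (l + d + 1 : ℕ) := Nat.cast_nonneg _
  linarith

/-- The series `∑ R_{l+d+1}/(2l+1)^2`, where `R` is the tail of the Leibniz series. -/
noncomputable def leibnizTailSum (d : ℕ) : ℝ :=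
  ∑' l : ℕ, leibnizTail (l + d + 1) / (2 * (l : ℝ) + 1) ^ 2

/-- The Leibniz series minus its shift by e. Each converges only conditionally, but the difference
of terms is O(1/l²), so the pair has an unconditional sum; its value is read off from partial sums.
-/
theorem hasSum_leibniz_sub (e : ℕ) :
    HasSum (fun l : ℕ => (-1 : ℝ) ^ l * (1 / (2 * (l : ℝ) + 1) - 1 / (2 * (l : ℝ) + 2 * e + 1)))
      (Real.pi / 4 - (-1) ^ e * leibnizTail e) := by
  have hsum : Summable fun l : ℕ =>
      (-1 : ℝ) ^ l * (1 / (2 * (l : ℝ) + 1) - 1 / (2 * (l : ℝ) + 2 * e + 1)) := by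
    refine Summable.of_norm_bounded (summable_one_div_odd_sq.mul_left (2 * (e : ℝ))) fun l => ?_
    rw [norm_mul, norm_pow, norm_neg, norm_one, one_pow, one_mul]
    have h : 1 / (2 * (l : ℝ) + 1) - 1 / (2 * (l : ℝ) + 2 * e + 1) =
        2 * e / ((2 * l + 1) * (2 * l + 2 * e + 1)) := by
      field_simp
      ring
    rw [h, Real.norm_of_nonneg (by positivity), mul_one_div, sq]
    gcongr
    linarith [e.cast_nonneg (α := ℝ)]
  have htail : Filter.Tendsto leibnizTail Filter.atTop (nhds 0) := by
    have h := Real.tendsto_sum_pi_div_four.const_sub (Real.pi / 4)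
    rw [sub_self] at h
    exact h
  have hpart : ∀ N : ℕ, ∑ l ∈ Finset.range N,
      (-1 : ℝ) ^ l * (1 / (2 * (l : ℝ) + 1) - 1 / (2 * (l : ℝ) + 2 * e + 1)) =
      (leibnizTail 0 - leibnizTail N) -
        (-1) ^ e * (leibnizTail e - leibnizTail (N + e)) := by
    intro N
    induction N with
    | zero => simp
    | succ N ih =>
      rw [Finset.sum_range_succ, ih, leibnizTail_succ, Nat.add_right_comm, leibnizTail_succ]
      have hs : ((-1 : ℝ) ^ e) * (-1) ^ e = 1 := by
        rw [← mul_pow]; simp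
      push_cast
      rw [pow_add]
      have e1 : 2 * ((N : ℝ) + e) + 1 = 2 * N + 2 * e + 1 := by ring
      rw [e1]
      linear_combination ((-1 : ℝ) ^ N / (2 * N + 2 * e + 1)) * hs
  have hlim := hsum.hasSum.tendsto_sum_nat
  have hlim2 : Filter.Tendsto (fun N => ∑ l ∈ Finset.range N,
      (-1 : ℝ) ^ l * (1 / (2 * (l : ℝ) + 1) - 1 / (2 * (l : ℝ) + 2 * e + 1))) Filter.atTop
      (nhds ((leibnizTail 0 - 0) - (-1) ^ e * (leibnizTail e - 0))) := by
    simp only [hpart]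
    exact (htail.const_sub _).sub
      ((((Filter.tendsto_add_atTop_iff_nat e).2 htail).const_sub _).const_mul _)
  rw [sub_zero, sub_zero, leibnizTail_zero] at hlim2
  rw [← tendsto_nhds_unique hlim hlim2]
  exact hsum.hasSum

/-- With a = 2l+1 and e = d+1, the termwise difference is ±1/(a²(a+2e)), and 1/(a²(a+2e)) = 1/(2e
a²) - (1/a - 1/(a+2e))/(4e²). -/
theorem leibnizTailSum_succ (d : ℕ) :
    leibnizTailSum (d + 1) = leibnizTailSum d -
      (-1) ^ (d + 1) * (catalanConstant / (2 * (d + 1 : ℝ)) -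
        (Real.pi / 4 - (-1) ^ (d + 1) * leibnizTail (d + 1)) / (4 * (d + 1 : ℝ) ^ 2)) := by
  have h1 := (summable_leibnizTail d).hasSum.sub (summable_leibnizTail (d + 1)).hasSum
  have h2 := ((hasSum_catalanConstant.div_const (2 * (d + 1 : ℝ))).sub
    ((hasSum_leibniz_sub (d + 1)).div_const (4 * (d + 1 : ℝ) ^ 2))).mul_left ((-1 : ℝ) ^ (d + 1))
  have h3 := h1.unique (h2.congr_fun fun l => ?_)
  · unfold leibnizTailSum
    linear_combination -h3
  · rw [show l + (d + 1) + 1 = (l + d + 1) + 1 by ring, leibnizTail_succ (l + d + 1)]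
    push_cast
    rw [show l + d + 1 = l + (d + 1) by ring, pow_add (-1 : ℝ) l (d + 1)]
    have : 2 * ((l : ℝ) + d + 1) + 1 ≠ 0 := by positivity
    have : (2 * (l : ℝ) + 2 * (d + 1) + 1) ≠ 0 := by positivity
    field_simp
    ring

/-! ### Derivatives of polylogarithms on the cut plane. -/

theorem hasSum_polylog_natCast {s : ℕ} (hs : 2 ≤ s) {z : ℂ} (hz : ‖z‖ ≤ 1) :
    HasSum (fun k : ℕ => z ^ (k + 1) / ((k : ℂ) + 1) ^ s) (polylog s z) := by
  have h := hasSum_polylog (s := (s : ℂ)) (by simpa using (by exact_mod_cast hs : (1 : ℝ) < s)) hz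
  simpa only [Complex.cpow_natCast] using h

/-- The operator z d/dz lowers the order by one. Starting from order s+1 ≥ 2 makes the series
uniformly dominated on the unit disc, so it may be differentiated term by term. -/
theorem hasSum_deriv_polylog {s : ℕ} (hs : 1 ≤ s) {z : ℂ} (hz : ‖z‖ < 1) :
    HasSum (fun k : ℕ => z ^ (k + 1) / ((k : ℂ) + 1) ^ s)
      (z * deriv (polylog ((s : ℂ) + 1)) z) := by
  have hsum : Summable fun k : ℕ => 1 / ((k : ℝ) + 1) ^ (s + 1) := by
    exact_mod_cast (summable_nat_add_iff 1).2 (Real.summable_one_div_nat_pow.2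
      (by omega : 1 < s + 1))
  have h := Complex.hasSum_deriv_of_summable_norm (U := Metric.ball (0 : ℂ) 1)
    (F := fun (k : ℕ) (w : ℂ) => w ^ (k + 1) / ((k : ℂ) + 1) ^ (s + 1)) hsum
    (fun k => by fun_prop) Metric.isOpen_ball
    (fun k w hw => by
      rw [norm_div, norm_pow, norm_pow]
      have e : ‖(k : ℂ) + 1‖ = (k : ℝ) + 1 := by
        exact_mod_cast Complex.norm_natCast (k + 1)
      rw [e]
      gcongr
      exact pow_le_one₀ (norm_nonneg _) (by simpa using (mem_ball_zero_iff.1 hw).le))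
    (mem_ball_zero_iff.2 hz)
  have heq : (fun w : ℂ => ∑' k : ℕ, w ^ (k + 1) / ((k : ℂ) + 1) ^ (s + 1)) =ᶠ[nhds z]
      polylog ((s : ℂ) + 1) := by
    filter_upwards [Metric.isOpen_ball.mem_nhds (mem_ball_zero_iff.2 hz)] with w hw
    have := (hasSum_polylog_natCast (s := s + 1) (by omega) (mem_ball_zero_iff.1 hw).le).tsum_eq
    rw [this]
    push_cast
    rfl
  rw [heq.deriv_eq] at h
  refine (h.mul_left z).congr_fun fun k => ?_
  have hk : (k : ℂ) + 1 ≠ 0 := by exact_mod_cast k.succ_ne_zero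
  rw [deriv_div_const, deriv_pow_field]
  push_cast
  field_simp
  ring

theorem isOpen_one_sub_mem_slitPlane : IsOpen {z : ℂ | 1 - z ∈ slitPlane} :=
  isOpen_slitPlane.preimage (by fun_prop)

theorem isPreconnected_one_sub_mem_slitPlane : IsPreconnected {z : ℂ | 1 - z ∈ slitPlane} := by
  have h : IsPreconnected slitPlane :=
    (starConvex_one_slitPlane.isPathConnected (by simp)).isConnected.isPreconnected
  have e : {z : ℂ | 1 - z ∈ slitPlane} = (fun w : ℂ => 1 - w) '' slitPlane := by
    ext z
    simp only [mem_ofPred_eq, mem_image]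
    exact ⟨fun hz => ⟨1 - z, hz, by ring⟩, fun ⟨w, hw, hwz⟩ => by rw [← hwz]; simpa using hw⟩
  rw [e]
  exact h.image _ (by fun_prop)

theorem differentiableOn_polylog_slitPlane {s : ℂ} (hs : 0 < s.re) :
    DifferentiableOn ℂ (polylog s) {z : ℂ | 1 - z ∈ slitPlane} := by
  refine (differentiableOn_polylog hs).mono fun z hz => ?_
  rintro ⟨h1, h2⟩
  rcases hz with hz | hz
  · simp at hz; linarith
  · simp [h1] at hz

/-- The points 1+ia with a ≠ 0 lie outside the closed disc, so identities proved from power series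
are carried to them by the identity theorem. -/
theorem eqOn_of_eqOn_ball {f g : ℂ → ℂ}
    (hf : DifferentiableOn ℂ f {z : ℂ | 1 - z ∈ slitPlane})
    (hg : DifferentiableOn ℂ g {z : ℂ | 1 - z ∈ slitPlane})
    (h : ∀ z : ℂ, ‖z‖ < 1 → f z = g z) : EqOn f g {z : ℂ | 1 - z ∈ slitPlane} := by
  refine (hf.analyticOnNhd isOpen_one_sub_mem_slitPlane).eqOn_of_preconnected_of_eventuallyEq
    (hg.analyticOnNhd isOpen_one_sub_mem_slitPlane) isPreconnected_one_sub_mem_slitPlane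
    (z₀ := 0) (by simp) ?_
  filter_upwards [Metric.isOpen_ball.mem_nhds (Metric.mem_ball_self one_pos)] with w hw
  exact h w (mem_ball_zero_iff.1 hw)

theorem hasDerivAt_polylog_three {z : ℂ} (hz : 1 - z ∈ slitPlane) (hz0 : z ≠ 0) :
    HasDerivAt (polylog 3) (polylog 2 z / z) z := by
  have h3 := differentiableOn_polylog_slitPlane (s := 3) (by simp)
  have h := eqOn_of_eqOn_ball (f := fun z => z * deriv (polylog 3) z) (g := polylog 2)
    (differentiableOn_id.mul (h3.deriv isOpen_one_sub_mem_slitPlane))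
    (differentiableOn_polylog_slitPlane (by simp)) (fun w hw => by
      have h1 := hasSum_deriv_polylog (s := 2) (by norm_num) hw
      have h2 := hasSum_polylog_natCast (s := 2) le_rfl hw.le
      rw [show ((2 : ℕ) : ℂ) + 1 = 3 by norm_num] at h1
      exact_mod_cast h1.unique h2) hz
  have hd := (h3.differentiableAt (isOpen_one_sub_mem_slitPlane.mem_nhds hz)).hasDerivAt
  rw [← h]
  simpa [hz0] using hd

theorem hasDerivAt_polylog_two {z : ℂ} (hz : 1 - z ∈ slitPlane) (hz0 : z ≠ 0) :
    HasDerivAt (polylog 2) (-Complex.log (1 - z) / z) z := by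
  have h2 := differentiableOn_polylog_slitPlane (s := 2) (by simp)
  have h : z * deriv (polylog 2) z = -Complex.log (1 - z) := eqOn_of_eqOn_ball
    (f := fun z => z * deriv (polylog 2) z) (g := fun z => -Complex.log (1 - z))
    (differentiableOn_id.mul (h2.deriv isOpen_one_sub_mem_slitPlane))
    (DifferentiableOn.clog (f := fun w => 1 - w) (by fun_prop) (fun w hw => hw)).neg (fun w hw => by
      have h1 := hasSum_deriv_polylog (s := 1) le_rfl hw
      have h2 := Complex.hasSum_taylorSeries_neg_log' hw
      rw [show ((1 : ℕ) : ℂ) + 1 = 2 by norm_num] at h1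
      refine h1.unique (h2.congr_fun fun k => ?_)
      simp) hz
  have hd := (h2.differentiableAt (isOpen_one_sub_mem_slitPlane.mem_nhds hz)).hasDerivAt
  rw [← h]
  simpa [hz0] using hd

/-! ### Boundary limits at 1 and special values of the dilogarithm. -/

/-- The point 1 is the end of the cut, so holomorphy gives no continuity there; dominated
convergence in the integral does. It fixes the constants of integration below. -/
theorem tendsto_polylog_one_add_I_mul {s : ℂ} (hs : 1 < s.re) :
    Filter.Tendsto (fun a : ℝ => polylog s (1 + I * a)) (nhdsWithin 0 (Ioi 0))
      (nhds (polylog s 1)) := by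
  have hpath : Filter.Tendsto (fun a : ℝ => 1 + I * (a : ℂ)) (nhdsWithin 0 (Ioi 0)) (nhds 1) := by
    have : Continuous fun a : ℝ => 1 + I * (a : ℂ) := by fun_prop
    simpa using (this.tendsto 0).mono_left nhdsWithin_le_nhds
  -- This is x/2 ≤ sinh(x/2). It yields the dominating function x^(Re s - 2) e^(-x/2), integrable
  -- because Re s > 1.
  have hpos : ∀ x ∈ Ioi (0 : ℝ), x * Real.exp (x / 2) ≤ Real.exp x - 1 := by
    intro x hx
    have h := Real.self_le_sinh_iff.2 (half_pos (mem_Ioi.1 hx)).le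
    rw [Real.sinh_eq] at h
    have h1 : Real.exp (x / 2) * Real.exp (x / 2) = Real.exp x := by
      rw [← Real.exp_add]; ring_nf
    have h2 : Real.exp (x / 2) * Real.exp (-(x / 2)) = 1 := by
      rw [← Real.exp_add]; simp
    nlinarith [Real.exp_pos (x / 2)]
  unfold polylog
  refine (hpath.div_const _).mul ?_
  refine tendsto_integral_filter_of_dominated_convergence
    (fun x : ℝ => x ^ (s.re - 2) * Real.exp (-(1 / 2) * x ^ (1 : ℝ)))
    (Filter.Eventually.of_forall fun a => ?_)
    (Filter.Eventually.of_forall fun a => ?_)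
    (integrableOn_rpow_mul_exp_neg_mul_rpow (by linarith) one_pos (by norm_num)) ?_
  · apply Measurable.aestronglyMeasurable
    fun_prop
  · refine (ae_restrict_iff' measurableSet_Ioi).2 (Filter.Eventually.of_forall fun x hx => ?_)
    have hx' : (0 : ℝ) < x := hx
    have h1 : x * Real.exp (x / 2) ≤ ‖Complex.exp x - (1 + I * a)‖ := by
      refine (hpos x hx).trans ((le_abs_self _).trans ?_)
      have e : Real.exp x - 1 = (Complex.exp x - (1 + I * a)).re := by
        simp [← Complex.ofReal_exp]
      rw [e]
      exact Complex.abs_re_le_norm _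
    rw [norm_div, Complex.norm_cpow_eq_rpow_re_of_pos hx']
    have h2 : x ^ (s.re - 2) * Real.exp (-(1 / 2) * x ^ (1 : ℝ)) =
        x ^ (s - 1).re / (x * Real.exp (x / 2)) := by
      have e1 : (s - 1).re = s.re - 2 + 1 := by simp; ring
      rw [e1, Real.rpow_add hx', Real.rpow_one, show -(1 / 2) * x = -(x / 2) by ring, Real.exp_neg]
      field_simp
    rw [h2]
    gcongr
  · refine (ae_restrict_iff' measurableSet_Ioi).2 (Filter.Eventually.of_forall fun x hx => ?_)
    have hx' : (0 : ℝ) < x := hx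
    refine tendsto_const_nhds.div (hpath.const_sub _) ?_
    rw [sub_ne_zero, ← Complex.ofReal_exp]
    exact_mod_cast (Real.one_lt_exp_iff.2 hx').ne'

theorem polylog_two_add_neg {z : ℂ} (hz : ‖z‖ ≤ 1) :
    polylog 2 z + polylog 2 (-z) = polylog 2 (z ^ 2) / 2 := by
  have h1 := (hasSum_polylog_natCast (s := 2) le_rfl hz).add
    (hasSum_polylog_natCast (s := 2) le_rfl (z := -z) (by simpa using hz))
  have h2 := (hasSum_polylog_natCast (s := 2) le_rfl (z := z ^ 2)
    (by rw [norm_pow]; exact pow_le_one₀ (norm_nonneg z) hz)).div_const 2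
  have hinj : Function.Injective fun l : ℕ => 2 * l + 1 := fun a b h => by simpa using h
  rw [← hinj.hasSum_iff] at h1
  · refine (h1.unique (h2.congr_fun fun l => ?_))
    have hl : (l : ℂ) + 1 ≠ 0 := by exact_mod_cast l.succ_ne_zero
    simp only [Function.comp_apply]
    rw [show 2 * l + 1 + 1 = 2 * (l + 1) by ring, pow_mul, pow_mul, neg_sq]
    push_cast
    rw [show (2 * (l : ℂ) + 1 + 1) = 2 * (l + 1) by ring]
    field_simp
    norm_num
  · intro k hk
    have hk' : Even k := by
      by_contra h
      obtain ⟨l, hl⟩ := Nat.not_even_iff_odd.1 h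
      exact hk ⟨l, hl.symm⟩
    rw [hk'.add_one.neg_pow]
    ring

/-- This is the inverse tangent integral Ti₂(a): only odd powers of i have an imaginary part. -/
theorem hasSum_polylog_two_I_mul_im {a : ℝ} (ha : |a| ≤ 1) :
    HasSum (fun l : ℕ => (-1) ^ l * a ^ (2 * l + 1) / (2 * (l : ℝ) + 1) ^ 2)
      (polylog 2 (I * a)).im := by
  have h1 := Complex.hasSum_im (hasSum_polylog_natCast (s := 2) le_rfl (z := I * a)
    (by simpa using ha))
  have hinj : Function.Injective fun l : ℕ => 2 * l := fun a b h => by simpa using h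
  have hterm : ∀ k : ℕ, (I * (a : ℂ)) ^ (k + 1) / ((k : ℂ) + 1) ^ 2 =
      I ^ (k + 1) * ((a ^ (k + 1) / ((k : ℝ) + 1) ^ 2 : ℝ) : ℂ) := by
    intro k
    push_cast
    rw [mul_pow]
    ring
  simp only [hterm] at h1
  rw [← hinj.hasSum_iff] at h1
  · refine (by exact_mod_cast h1 : HasSum _ (polylog 2 (I * a)).im).congr_fun fun l => ?_
    simp only [Function.comp_apply]
    rw [pow_succ I, pow_mul, Complex.I_sq, show ((-1 : ℂ) ^ l) = (((-1) ^ l : ℝ) : ℂ) by push_cast; rfl]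
    rw [mul_assoc, Complex.im_ofReal_mul, mul_comm, Complex.im_mul_ofReal, Complex.I_im]
    push_cast
    ring
  · intro k hk
    have hk' : Odd k := by
      by_contra h
      obtain ⟨l, hl⟩ := Nat.not_odd_iff_even.1 h
      exact hk ⟨l, by simp only; omega⟩
    obtain ⟨l, rfl⟩ := hk'
    rw [show 2 * l + 1 + 1 = 2 * (l + 1) by ring, pow_mul I, Complex.I_sq,
      show ((-1 : ℂ) ^ (l + 1)) = (((-1) ^ (l + 1) : ℝ) : ℂ) by push_cast; rfl,
      ← Complex.ofReal_mul, Complex.ofReal_im]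

theorem polylog_two_one : polylog 2 1 = (Real.pi : ℂ) ^ 2 / 6 := by
  have h1 := hasSum_polylog_natCast (s := 2) le_rfl (z := 1) (by simp)
  have h2 := (Complex.hasSum_ofReal.2 ((hasSum_nat_add_iff' 1).2 hasSum_zeta_two))
  have h3 := h1.unique (h2.congr_fun fun k => by push_cast; simp)
  push_cast at h3
  simpa using h3

theorem polylog_two_conj {z : ℂ} (hz : ‖z‖ ≤ 1) :
    polylog 2 ((starRingEnd ℂ) z) = (starRingEnd ℂ) (polylog 2 z) := by
  have h1 := hasSum_polylog_natCast (s := 2) le_rfl (z := (starRingEnd ℂ) z)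
    (by simpa using hz)
  have h2 := Complex.hasSum_conj'.2 (hasSum_polylog_natCast (s := 2) le_rfl hz)
  refine (h1.unique (h2.congr_fun fun k => ?_))
  simp

theorem polylog_two_I_im : (polylog 2 I).im = catalanConstant := by
  have h := hasSum_polylog_two_I_mul_im (a := 1) (by simp)
  simp only [one_pow, mul_one, Complex.ofReal_one] at h
  exact h.unique hasSum_catalanConstant

theorem polylog_two_I : polylog 2 I = -(Real.pi : ℂ) ^ 2 / 48 + catalanConstant * I := by
  -- Duplication at 1 gives Li₂(-1) = -π²/12, and duplication at i gives 2 Re Li₂(i) = Li₂(-1)/2.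
  have hre : (polylog 2 I).re = -Real.pi ^ 2 / 48 := by
    have h1 := polylog_two_add_neg (z := 1) (by simp)
    have h2 := polylog_two_add_neg (z := I) (by simp)
    have h3 := polylog_two_conj (z := I) (by simp)
    rw [Complex.conj_I] at h3
    rw [one_pow, polylog_two_one] at h1
    rw [Complex.I_sq, h3, Complex.add_conj] at h2
    have h4 : (((polylog 2 I).re : ℝ) : ℂ) = ((-Real.pi ^ 2 / 48 : ℝ) : ℂ) := by
      push_cast at h2 ⊢
      linear_combination h2 / 2 + h1 / 4
    exact_mod_cast h4
  apply Complex.ext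
  · rw [hre]
    have : -(Real.pi : ℂ) ^ 2 / 48 = ((-Real.pi ^ 2 / 48 : ℝ) : ℂ) := by push_cast; rfl
    rw [this]
    simp only [Complex.add_re, Complex.ofReal_re, Complex.re_ofReal_mul, Complex.I_re, mul_zero,
      add_zero]
  · rw [polylog_two_I_im]
    have : -(Real.pi : ℂ) ^ 2 / 48 = ((-Real.pi ^ 2 / 48 : ℝ) : ℂ) := by push_cast; rfl
    rw [this]
    simp only [Complex.add_im, Complex.ofReal_im, Complex.im_ofReal_mul, Complex.I_im, mul_one,
      zero_add]

theorem one_add_I_mul_mem_slitPlane (a : ℝ) : 1 + I * (a : ℂ) ∈ slitPlane :=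
  Or.inl (by simp)

theorem one_sub_one_add_I_mul_mem_slitPlane {a : ℝ} (ha : a ≠ 0) :
    1 - (1 + I * (a : ℂ)) ∈ slitPlane :=
  Or.inr (by simpa using ha)

theorem hasDerivAt_one_add_I_mul (a : ℝ) : HasDerivAt (fun a : ℝ => 1 + I * (a : ℂ)) I a := by
  simpa using ((hasDerivAt_id a).ofReal_comp.const_mul I).const_add 1

theorem tendsto_log_one_add_I_mul :
    Filter.Tendsto (fun a : ℝ => Complex.log (1 + I * a)) (nhdsWithin 0 (Ioi 0)) (nhds 0) := by
  have h : ContinuousAt (fun a : ℝ => Complex.log (1 + I * a)) 0 :=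
    ContinuousAt.clog (by fun_prop) (one_add_I_mul_mem_slitPlane 0)
  simpa using h.tendsto.mono_left nhdsWithin_le_nhds

/-- The first factor is O(a), by its derivative at 0, and the second is log a - iπ/2, so the product
behaves like a log a. -/
theorem tendsto_log_mul_log_one_add_I_mul :
    Filter.Tendsto (fun a : ℝ => Complex.log (1 + I * a) * Complex.log (1 - (1 + I * a)))
      (nhdsWithin 0 (Ioi 0)) (nhds 0) := by
  have h1 : HasDerivAt (fun a : ℝ => Complex.log (1 + I * a)) (I / (1 + I * (0 : ℝ))) 0 :=
    (hasDerivAt_one_add_I_mul 0).clog_real (one_add_I_mul_mem_slitPlane 0)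
  have h2 := (hasDerivAt_iff_tendsto_slope.1 h1).mono_left
    (nhdsWithin_mono 0 fun x (hx : 0 < x) => hx.ne')
  have h3 : Filter.Tendsto (fun a : ℝ => (a : ℂ) * Complex.log (1 - (1 + I * a)))
      (nhdsWithin 0 (Ioi 0)) (nhds 0) := by
    have h4 : Filter.Tendsto (fun a : ℝ => ((Real.log a * a : ℝ) : ℂ) - a * (Real.pi / 2 * I))
        (nhdsWithin 0 (Ioi 0)) (nhds (((0 : ℝ) : ℂ) - (0 : ℝ) * (Real.pi / 2 * I))) := by
      refine Filter.Tendsto.sub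
        ((Complex.continuous_ofReal.tendsto 0).comp (by simpa only [Real.rpow_one] using tendsto_log_mul_rpow_nhdsGT_zero zero_lt_one))
        (Filter.Tendsto.mul_const _ ?_)
      exact (Complex.continuous_ofReal.tendsto 0).mono_left nhdsWithin_le_nhds
    simp only [Complex.ofReal_zero, zero_mul, sub_zero] at h4
    refine h4.congr' ?_
    filter_upwards [self_mem_nhdsWithin] with a ha
    have ha' : (0 : ℝ) < a := ha
    rw [show 1 - (1 + I * (a : ℂ)) = a * (-I) by ring,
      Complex.log_ofReal_mul ha' (by simp), Complex.log_neg_I]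
    push_cast
    ring
  have h5 := h2.mul h3
  rw [mul_zero] at h5
  refine h5.congr' ?_
  filter_upwards [self_mem_nhdsWithin] with a ha
  have ha' : (a : ℂ) ≠ 0 := by exact_mod_cast (ne_of_gt ha : a ≠ 0)
  simp only [slope, vsub_eq_sub, sub_zero, Complex.ofReal_zero, mul_zero, add_zero,
    Complex.log_one, Complex.real_smul, Complex.ofReal_inv]
  field_simp

/-- Euler's reflection formula on the ray 1+ia: the derivative in a vanishes, and letting a → 0+
identifies the constant. -/
theorem polylog_two_reflection {a : ℝ} (ha : 0 < a) :
    polylog 2 (1 + I * a) + polylog 2 (1 - (1 + I * a)) +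
      Complex.log (1 + I * a) * Complex.log (1 - (1 + I * a)) = polylog 2 1 := by
  set f : ℝ → ℂ := fun a => polylog 2 (1 + I * a) + polylog 2 (1 - (1 + I * a)) +
    Complex.log (1 + I * a) * Complex.log (1 - (1 + I * a)) with hf
  have hder : ∀ x ∈ Ioi (0 : ℝ), HasDerivAt f 0 x := by
    intro x hx
    have hx' : (0 : ℝ) < x := hx
    have hz := one_add_I_mul_mem_slitPlane x
    have hz1 := one_sub_one_add_I_mul_mem_slitPlane hx'.ne'
    have hp := hasDerivAt_one_add_I_mul x
    have hz0 := slitPlane_ne_zero hz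
    have hz10 := slitPlane_ne_zero hz1
    have h1 := (hasDerivAt_polylog_two hz1 hz0).comp_of_eq x hp rfl
    have h2 := (hasDerivAt_polylog_two (z := 1 - (1 + I * x)) (by simpa using hz) hz10).comp_of_eq x
      (hp.const_sub 1) rfl
    have h3 := (hp.clog_real hz).mul ((hp.const_sub 1).clog_real hz1)
    have h := (h1.add h2).add h3
    refine h.congr_deriv ?_
    rw [sub_sub_cancel]
    field_simp
    ring
  have hconst : ∀ x ∈ Ioi (0 : ℝ), f x = f a := fun x hx =>
    isOpen_Ioi.is_const_of_deriv_eq_zero isPreconnected_Ioi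
      (fun y hy => (hder y hy).differentiableAt.differentiableWithinAt)
      (fun y hy => (hder y hy).deriv) hx ha
  have hlim : Filter.Tendsto f (nhdsWithin 0 (Ioi 0)) (nhds (polylog 2 1 + 0 + 0)) := by
    refine ((tendsto_polylog_one_add_I_mul (by simp)).add ?_).add tendsto_log_mul_log_one_add_I_mul
    have hc : ContinuousAt (polylog 2) 0 :=
      ((differentiableOn_polylog_slitPlane (s := 2) (by simp)).differentiableAt
        (isOpen_one_sub_mem_slitPlane.mem_nhds (by simp))).continuousAt
    have hp : Filter.Tendsto (fun a : ℝ => 1 - (1 + I * (a : ℂ))) (nhdsWithin 0 (Ioi 0))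
        (nhds 0) := by
      have : Continuous fun a : ℝ => 1 - (1 + I * (a : ℂ)) := by fun_prop
      simpa using (this.tendsto 0).mono_left nhdsWithin_le_nhds
    have h0 : polylog 2 0 = 0 := by simp [polylog]
    rw [← h0]
    exact hc.tendsto.comp hp
  have hlim2 : Filter.Tendsto f (nhdsWithin 0 (Ioi 0)) (nhds (f a)) := by
    refine tendsto_const_nhds.congr' ?_
    filter_upwards [self_mem_nhdsWithin] with x hx
    exact (hconst x hx).symm
  rw [add_zero, add_zero] at hlim
  exact tendsto_nhds_unique hlim2 hlim

theorem log_one_add_I_mul_re (a : ℝ) :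
    (Complex.log (1 + I * a)).re = Real.log (1 + a ^ 2) / 2 := by
  have h : ‖1 + I * (a : ℂ)‖ = Real.sqrt (1 + a ^ 2) := by
    rw [Complex.norm_def, Complex.normSq_apply]
    congr 1
    simp
    ring
  rw [Complex.log_re, h, Real.log_sqrt (by positivity)]

theorem log_one_add_I : Complex.log (1 + I) = (Real.log 2 / 2 : ℝ) + (Real.pi / 4 : ℝ) * I := by
  have h := log_one_add_I_mul_re 1
  apply Complex.ext
  · norm_num at h
    rw [h]
    simp only [Complex.add_re, Complex.ofReal_re, Complex.re_ofReal_mul, Complex.I_re, mul_zero,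
      add_zero]
  · have e : 1 + I = (Real.sqrt 2 : ℝ) *
        (Complex.cos (Real.pi / 4 : ℝ) + Complex.sin (Real.pi / 4 : ℝ) * I) := by
      rw [← Complex.ofReal_cos, ← Complex.ofReal_sin, Real.cos_pi_div_four, Real.sin_pi_div_four]
      have h2 : ((Real.sqrt 2 : ℝ) : ℂ) * (Real.sqrt 2 : ℝ) = 2 := by
        rw [← Complex.ofReal_mul, Real.mul_self_sqrt (by norm_num)]
        norm_num
      push_cast
      linear_combination (-(1 + I) / 2) * h2
    rw [Complex.log_im, e, Complex.arg_mul_cos_add_sin_mul_I (by positivity)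
      ⟨by linarith [Real.pi_pos], by linarith [Real.pi_pos]⟩]
    simp only [Complex.add_im, Complex.ofReal_im, Complex.im_ofReal_mul, Complex.I_im, mul_one,
      zero_add]

/-- Reflection at a = 1, where 1 - (1+i) is the conjugate of i. -/
theorem polylog_two_one_add_I :
    polylog 2 (1 + I) = (Real.pi ^ 2 / 16 : ℝ) +
      (catalanConstant + Real.pi * Real.log 2 / 4 : ℝ) * I := by
  have h := polylog_two_reflection one_pos
  rw [Complex.ofReal_one, mul_one, show 1 - (1 + I) = (starRingEnd ℂ) I by simp,
    polylog_two_conj (by simp), polylog_two_I, polylog_two_one, Complex.conj_I, log_one_add_I,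
    Complex.log_neg_I] at h
  simp only [map_add, map_mul, map_neg, map_div₀, map_pow, Complex.conj_ofReal, Complex.conj_I,
    map_ofNat] at h
  push_cast at h ⊢
  linear_combination h + (Real.pi ^ 2 / 8 : ℂ) * Complex.I_sq

/-! ### The primitive and the value of S_0. -/

theorem differentiableAt_polylog_two_I_mul (a : ℝ) : DifferentiableAt ℂ (polylog 2) (I * a) :=
  (differentiableOn_polylog_slitPlane (s := 2) (by simp)).differentiableAt
    (isOpen_one_sub_mem_slitPlane.mem_nhds (Or.inl (by simp)))

theorem continuous_polylog_two_I_mul : Continuous fun a : ℝ => polylog 2 (I * a) :=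
  continuous_iff_continuousAt.2 fun a =>
    ContinuousAt.comp (f := fun a : ℝ => I * (a : ℂ))
      (differentiableAt_polylog_two_I_mul a).continuousAt (by fun_prop)

/-- A primitive on `(0, ∞)` of `a * Im (Li₂ (i a)) / (1 + a ^ 2)` that vanishes at `0+`. -/
noncomputable def landenPrimitive (a : ℝ) : ℝ :=
  (polylog 3 (1 + I * a) - Complex.log (1 + I * a) * polylog 2 (1 + I * a) -
    Complex.log (1 + I * a) ^ 2 * Complex.log (1 - (1 + I * a)) / 2).im +
    Real.log (1 + a ^ 2) / 2 * (polylog 2 (I * a)).im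

/-- With z = 1+ia, all terms in the derivative of the bracket cancel except -log² z/(2a). Its
imaginary part is -log(1+a²) arg z/(2a). The derivative of Im Li₂(ia) is arg z / a, so the product
rule on the last summand cancels this and leaves the stated integrand. -/
theorem hasDerivAt_landenPrimitive {a : ℝ} (ha : 0 < a) :
    HasDerivAt landenPrimitive (a * (polylog 2 (I * a)).im / (1 + a ^ 2)) a := by
  have hz := one_add_I_mul_mem_slitPlane a
  have hz1 := one_sub_one_add_I_mul_mem_slitPlane ha.ne'
  have hp := hasDerivAt_one_add_I_mul a
  have hz0 := slitPlane_ne_zero hz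
  have hz10 := slitPlane_ne_zero hz1
  have ha0 : (a : ℂ) ≠ 0 := by exact_mod_cast ha.ne'
  have h3 := (hasDerivAt_polylog_three hz1 hz0).comp_of_eq a hp rfl
  have h2 := (hasDerivAt_polylog_two hz1 hz0).comp_of_eq a hp rfl
  have hl := hp.clog_real hz
  have hl1 := (hp.const_sub 1).clog_real hz1
  have hT : HasDerivAt (fun a : ℝ => polylog 3 (1 + I * a) -
      Complex.log (1 + I * a) * polylog 2 (1 + I * a) -
      Complex.log (1 + I * a) ^ 2 * Complex.log (1 - (1 + I * a)) / 2)
      (((-(1 / (2 * a)) : ℝ) : ℂ) * Complex.log (1 + I * a) ^ 2) a := by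
    refine ((h3.sub (hl.mul h2)).sub (((hl.pow 2).mul hl1).div_const 2)).congr_deriv ?_
    have e : 1 - (1 + I * (a : ℂ)) = -(I * a) := by ring
    simp only [e, Function.comp_apply, Pi.pow_apply]
    push_cast
    field_simp
    ring
  have hTim := Complex.imCLM.hasFDerivAt.comp_hasDerivAt a hT
  have hL : HasDerivAt (fun a : ℝ => Real.log (1 + a ^ 2) / 2) (a / (1 + a ^ 2)) a := by
    have h : HasDerivAt (fun a : ℝ => 1 + a ^ 2) (2 * a) a := by
      simpa using ((hasDerivAt_id a).pow 2).const_add 1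
    refine ((h.log (by positivity)).div_const 2).congr_deriv ?_
    field_simp
  have hq : HasDerivAt (fun a : ℝ => I * (a : ℂ)) I a := by
    simpa using (hasDerivAt_id a).ofReal_comp.const_mul I
  have hP := (hasDerivAt_polylog_two (z := I * a) (Or.inl (by simp))
    (by simpa using ha.ne')).comp_of_eq a hq rfl
  have hPim := Complex.imCLM.hasFDerivAt.comp_hasDerivAt a hP
  have hconj : Complex.log (1 - I * a) = (starRingEnd ℂ) (Complex.log (1 + I * a)) := by
    rw [← Complex.log_conj _ (Complex.slitPlane_arg_ne_pi hz)]
    simp [sub_eq_add_neg]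
  have e2 : -Complex.log (1 - I * a) / (I * a) * I =
      ((1 / a : ℝ) : ℂ) * -Complex.log (1 - I * a) := by
    push_cast
    field_simp
  refine (hTim.add (hL.mul hPim)).congr_deriv ?_
  have e3 : (((-(1 / (2 * a)) : ℝ) : ℂ) * Complex.log (1 + I * a) ^ 2).im =
      -(1 / (2 * a)) * (Real.log (1 + a ^ 2) * (Complex.log (1 + I * a)).im) := by
    rw [Complex.im_ofReal_mul, sq, Complex.mul_im, log_one_add_I_mul_re]
    ring
  have e4 : (-Complex.log (1 - I * a) / (I * a) * I).im =
      1 / a * (Complex.log (1 + I * a)).im := by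
    rw [e2, hconj, Complex.im_ofReal_mul, Complex.neg_im, Complex.conj_im, neg_neg]
  simp only [Complex.imCLM_apply, Function.comp_apply, e3, e4]
  field_simp
  ring

theorem tendsto_landenPrimitive_zero :
    Filter.Tendsto landenPrimitive (nhdsWithin 0 (Ioi 0)) (nhds 0) := by
  have h3 := tendsto_polylog_one_add_I_mul (s := 3) (by simp)
  have h2 := tendsto_polylog_one_add_I_mul (s := 2) (by simp)
  have hl := tendsto_log_one_add_I_mul
  -- Since log(1-z) diverges, log² z log(1-z) must be grouped as log z · (log z log(1-z)).
  have hll := tendsto_log_mul_log_one_add_I_mul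
  have hT := ((h3.sub (hl.mul h2)).sub ((hl.mul hll).div_const 2))
  have hTim := (Complex.continuous_im.tendsto _).comp hT
  have hc : Continuous fun a : ℝ => Real.log (1 + a ^ 2) / 2 * (polylog 2 (I * a)).im := by
    refine Continuous.mul ?_ (Complex.continuous_im.comp continuous_polylog_two_I_mul)
    exact (Continuous.log (by fun_prop) fun a => by positivity).div_const _
  have hR := (hc.tendsto 0).mono_left (nhdsWithin_le_nhds (s := Ioi 0))
  have h := hTim.add hR
  have him : (polylog 3 1).im = 0 := by
    have h1 := Complex.hasSum_im (hasSum_polylog_natCast (s := 3) (by norm_num) (z := 1) (by simp))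
    refine (h1.unique (hasSum_zero.congr_fun fun k => ?_))
    rw [one_pow, show 1 / ((k : ℂ) + 1) ^ 3 = ((1 / ((k : ℝ) + 1) ^ 3 : ℝ) : ℂ) by push_cast; rfl,
      Complex.ofReal_im]
  simp only [zero_mul, sub_zero, zero_div, him, Real.log_one, add_zero, ne_eq, OfNat.ofNat_ne_zero,
    not_false_eq_true, zero_pow] at h
  refine h.congr fun a => ?_
  simp only [landenPrimitive, Function.comp_apply]
  congr 3
  ring

/-- Catalan's constant cancels between log z Li₂(z) and the last summand. -/
theorem landenPrimitive_one : landenPrimitive 1 =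
    (polylog 3 (1 + I)).im - Real.pi * Real.log 2 ^ 2 / 16 - Real.pi ^ 3 / 32 := by
  unfold landenPrimitive
  rw [Complex.ofReal_one, mul_one, show 1 - (1 + I) = -I by ring, Complex.log_neg_I,
    polylog_two_one_add_I, log_one_add_I]
  rw [polylog_two_I_im]
  set G := catalanConstant
  set l := Real.log 2
  have e1 : ((l / 2 : ℝ) + (Real.pi / 4 : ℝ) * I) * ((Real.pi ^ 2 / 16 : ℝ) +
      (G + Real.pi * l / 4 : ℝ) * I) =
      ((l / 2 * (Real.pi ^ 2 / 16) - Real.pi / 4 * (G + Real.pi * l / 4) : ℝ) : ℂ) +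
      ((l / 2 * (G + Real.pi * l / 4) + Real.pi / 4 * (Real.pi ^ 2 / 16) : ℝ) : ℂ) * I := by
    push_cast
    linear_combination ((Real.pi : ℂ) / 4 * (G + Real.pi * l / 4)) * Complex.I_sq
  have e2 : ((l / 2 : ℝ) + (Real.pi / 4 : ℝ) * I) ^ 2 * (-(Real.pi / 2 * I)) / 2 =
      ((Real.pi ^ 2 * l / 16 : ℝ) : ℂ) +
      ((-Real.pi / 4 * (l ^ 2 / 4 - Real.pi ^ 2 / 16) : ℝ) : ℂ) * I := by
    push_cast
    linear_combination (-(Real.pi : ℂ) ^ 2 * l / 16 - Real.pi ^ 3 / 64 * I) * Complex.I_sq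
  rw [e1]
  rw [show (-((Real.pi : ℂ) / 2) * I) = -(Real.pi / 2 * I) by ring, e2]
  simp only [Complex.sub_im, Complex.add_im, Complex.ofReal_im, Complex.im_ofReal_mul,
    Complex.I_im]
  norm_num
  ring

theorem integral_polylog_two_I_mul :
    ∫ a in (0 : ℝ)..1, a * (polylog 2 (I * a)).im / (1 + a ^ 2) = landenPrimitive 1 := by
  have hc : Continuous fun a : ℝ => a * (polylog 2 (I * a)).im / (1 + a ^ 2) :=
    (continuous_id.mul (Complex.continuous_im.comp continuous_polylog_two_I_mul)).div
      (by fun_prop) fun a => by positivity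
  have h := intervalIntegral.integral_eq_sub_of_hasDerivAt_of_tendsto zero_lt_one
    (fun x hx => hasDerivAt_landenPrimitive hx.1) (hc.intervalIntegrable _ _)
    tendsto_landenPrimitive_zero
    ((hasDerivAt_landenPrimitive one_pos).continuousAt.tendsto.mono_left nhdsWithin_le_nhds)
  rw [h, sub_zero]

/-- Splitting x^(2l+2) = x · x^(2l+1) exposes the series of Im Li₂(ix) under the integral; the
constants 1/(2l+1)² dominate. -/
theorem leibnizTailSum_zero : leibnizTailSum 0 =
    -(polylog 3 (1 + I)).im + Real.pi * Real.log 2 ^ 2 / 16 + Real.pi ^ 3 / 32 := by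
  have hcont : ∀ l : ℕ, Continuous fun x : ℝ =>
      (-1) ^ (l + 1) * (x ^ (2 * (l + 1)) / (1 + x ^ 2)) / (2 * (l : ℝ) + 1) ^ 2 := fun l =>
    (continuous_const.mul ((by fun_prop : Continuous fun x : ℝ => x ^ (2 * (l + 1))).div
      (by fun_prop) fun x => by positivity)).div_const _
  have h := intervalIntegral.hasSum_integral_of_dominated_convergence (a := (0 : ℝ)) (b := 1)
    (μ := volume)
    (F := fun (l : ℕ) (x : ℝ) =>
      (-1) ^ (l + 1) * (x ^ (2 * (l + 1)) / (1 + x ^ 2)) / (2 * (l : ℝ) + 1) ^ 2)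
    (f := fun x => -(x * (polylog 2 (I * x)).im / (1 + x ^ 2)))
    (fun l _ => 1 / (2 * (l : ℝ) + 1) ^ 2)
    (fun l => (hcont l).aestronglyMeasurable)
    (fun l => Filter.Eventually.of_forall fun x hx => by
      rw [uIoc_of_le zero_le_one] at hx
      have hx0 := hx.1.le
      rw [norm_div, norm_mul, norm_pow, norm_neg, norm_one, one_pow, one_mul,
        Real.norm_of_nonneg (div_nonneg (pow_nonneg hx0 _) (by positivity)),
        Real.norm_of_nonneg (by positivity)]
      gcongr
      rw [div_le_one (by positivity)]
      have := pow_le_one₀ (n := 2 * (l + 1)) hx0 hx.2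
      nlinarith [sq_nonneg x])
    (Filter.Eventually.of_forall fun x _ => summable_one_div_odd_sq)
    intervalIntegrable_const
    (Filter.Eventually.of_forall fun x hx => by
      rw [uIoc_of_le zero_le_one] at hx
      have hs := (hasSum_polylog_two_I_mul_im (a := x)
        (by rw [abs_of_nonneg hx.1.le]; exact hx.2)).mul_left (-(x / (1 + x ^ 2)))
      rw [show -(x * (polylog 2 (I * x)).im / (1 + x ^ 2)) =
        -(x / (1 + x ^ 2)) * (polylog 2 (I * x)).im by ring]
      refine hs.congr_fun fun l => ?_
      rw [pow_succ (-1 : ℝ) l, show 2 * (l + 1) = (2 * l + 1) + 1 by ring, pow_succ x (2 * l + 1)]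
      ring)
  rw [intervalIntegral.integral_neg, integral_polylog_two_I_mul, landenPrimitive_one] at h
  have h2 := (summable_leibnizTail 0).hasSum.unique (h.congr_fun fun l => ?_)
  · unfold leibnizTailSum
    rw [h2]
    ring
  · rw [leibnizTail_eq_integral, ← intervalIntegral.integral_const_mul,
      ← intervalIntegral.integral_div]

/-! ### Assembly of the closed forms. -/

theorem sum_Icc_leibniz (N : ℕ) :
    ∑ j ∈ Finset.Icc 0 N, (-1 : ℝ) ^ j / (2 * (j : ℝ) + 1) =
      Real.pi / 4 - leibnizTail (N + 1) := by
  rw [leibnizTail, Finset.range_eq_Ico, Finset.Ico_add_one_right_eq_Icc]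
  ring

theorem hasSum_theta2Term (m d : ℕ) :
    HasSum (fun k : ℕ => theta2Term (m + d) (2 * m + 1) (k + 1))
      ((4 * (-1) ^ (m + d + 1) * (leibnizTailSum d -
        ∑ l ∈ Finset.range (m + 1), leibnizTail (l + d + 1) / (2 * (l : ℝ) + 1) ^ 2) : ℝ) : ℂ) := by
  -- The series starts at k = 1, that is at l = m+1, so the m+1 terms l = 0, …, m are removed from
  -- S_d.
  have h := (((hasSum_nat_add_iff' (m + 1)).2 (summable_leibnizTail d).hasSum).mul_left
    (4 * (-1 : ℝ) ^ (m + d + 1)))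
  refine (Complex.hasSum_ofReal.2 h).congr_fun fun k => ?_
  rw [theta2Term_eq_leibnizTail, show k + 1 + (m + d) + 1 = k + (m + 1) + d + 1 by ring]
  push_cast
  ring

/-- The part of `Θ₂(m + d, 2m + 1)`, up to the factor `(-1)^m`, that does not depend on `m`. -/
noncomputable def thetaConst (d : ℕ) : ℝ :=
  4 * (-1) ^ (d + 1) * (leibnizTailSum d - leibnizTail (d + 1))

/-- The removed term l = 0 goes into `thetaConst`. For 1 ≤ l ≤ m, each tail is π/4 minus a finite
alternating sum, which gives the π term and the double sum. -/
theorem hasSum_theta2Term_thetaConst (m d : ℕ) :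
    HasSum (fun k : ℕ => theta2Term (m + d) (2 * m + 1) (k + 1))
      (((-1) ^ m * (thetaConst d
        + (-1) ^ d * (∑ k ∈ Finset.Icc 1 m, 1 / (2 * (k : ℝ) + 1) ^ 2) * Real.pi
        - 4 * ∑ k ∈ Finset.Icc 1 m, ∑ j ∈ Finset.Icc 0 (k + d),
            (-1 : ℝ) ^ (j + d) / ((2 * (j : ℝ) + 1) * (2 * (k : ℝ) + 1) ^ 2)) : ℝ) : ℂ) := by
  have hin : ∀ k : ℕ, ∑ j ∈ Finset.Icc 0 (k + d),
      (-1 : ℝ) ^ (j + d) / ((2 * (j : ℝ) + 1) * (2 * (k : ℝ) + 1) ^ 2) =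
      (-1) ^ d * (Real.pi / 4) * (1 / (2 * (k : ℝ) + 1) ^ 2) -
        (-1) ^ d * (leibnizTail (k + d + 1) / (2 * (k : ℝ) + 1) ^ 2) := by
    intro k
    have h : ∀ j : ℕ, (-1 : ℝ) ^ (j + d) / ((2 * (j : ℝ) + 1) * (2 * (k : ℝ) + 1) ^ 2) =
        (-1) ^ d / (2 * (k : ℝ) + 1) ^ 2 * ((-1) ^ j / (2 * (j : ℝ) + 1)) := by
      intro j
      rw [pow_add]
      field_simp
    simp only [h]
    rw [← Finset.mul_sum, sum_Icc_leibniz]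
    ring
  have hr : ∑ l ∈ Finset.range (m + 1), leibnizTail (l + d + 1) / (2 * (l : ℝ) + 1) ^ 2 =
      leibnizTail (d + 1) +
        ∑ l ∈ Finset.Icc 1 m, leibnizTail (l + d + 1) / (2 * (l : ℝ) + 1) ^ 2 := by
    rw [Finset.range_eq_Ico, Finset.sum_eq_sum_Ico_succ_bot (by omega),
      Finset.Ico_add_one_right_eq_Icc]
    simp
  convert hasSum_theta2Term m d using 2
  simp only [hin, Finset.sum_sub_distrib, ← Finset.mul_sum]
  rw [hr, thetaConst]
  ring

/-- Induction on p, each step applying the recursion in d twice. Every tail involved is R_{2p+1}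
plus a rational number, so the step is an identity of rational functions in p, linear in R_{2p+1}.
-/
theorem thetaConst_even (p : ℕ) : thetaConst (2 * p) =
    -4 + 1 / 4 * ∑ j ∈ Finset.Icc 1 p, 1 / ((j : ℝ) ^ 2 * (4 * (j : ℝ) - 1))
      - 1 / 4 * ∑ k ∈ Finset.Icc 1 p, ∑ j ∈ Finset.Icc 0 (2 * k - 2),
          (-1 : ℝ) ^ j * (8 * (k : ℝ) ^ 2 - 4 * (k : ℝ) + 1) /
            ((k : ℝ) ^ 2 * (2 * (j : ℝ) + 1) * (2 * (k : ℝ) - 1) ^ 2)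
      - 4 * ∑ j ∈ Finset.Icc 1 (2 * p), (-1 : ℝ) ^ j / (2 * (j : ℝ) + 1)
      + (1 + 1 / 2 * ∑ j ∈ Finset.Icc 1 p, 1 / (2 * (j : ℝ) - 1) ^ 2) * Real.pi
      - Real.pi / 4 * Real.log 2 ^ 2
      - Real.pi ^ 3 / 8
      - catalanConstant * ∑ j ∈ Finset.Icc 1 p, 1 / ((j : ℝ) * (2 * (j : ℝ) - 1))
      + 4 * (polylog 3 (1 + I)).im := by
  induction p with
  | zero =>
    simp [thetaConst, leibnizTailSum_zero, leibnizTail_succ, leibnizTail_zero]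
    ring
  | succ p ih =>
    -- The numerator splits as 8k²-4k+1 = (2k-1)² + 4k², giving the weights 1/k² and 4/(2k-1)² of
    -- the two recursion steps.
    have hin : ∑ j ∈ Finset.Icc 0 (2 * (p + 1) - 2),
          (-1 : ℝ) ^ j * (8 * ((p + 1 : ℕ) : ℝ) ^ 2 - 4 * ((p + 1 : ℕ) : ℝ) + 1) /
            (((p + 1 : ℕ) : ℝ) ^ 2 * (2 * (j : ℝ) + 1) * (2 * ((p + 1 : ℕ) : ℝ) - 1) ^ 2) =
        (1 / ((p : ℝ) + 1) ^ 2 + 4 / (2 * p + 1) ^ 2) *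
          (Real.pi / 4 - leibnizTail (2 * p + 1)) := by
      rw [show 2 * (p + 1) - 2 = 2 * p by omega, ← sum_Icc_leibniz, Finset.mul_sum]
      refine Finset.sum_congr rfl fun j _ => ?_
      push_cast
      rw [show 2 * ((p : ℝ) + 1) - 1 = 2 * p + 1 by ring]
      field_simp
      ring
    have hpar : (-1 : ℝ) ^ (2 * p) = 1 := by simp
    rw [Finset.sum_Icc_succ_top (by omega), Finset.sum_Icc_succ_top (by omega),
      Finset.sum_Icc_succ_top (by omega), Finset.sum_Icc_succ_top (by omega), hin,
      show 2 * (p + 1) = 2 * p + 1 + 1 by ring, Finset.sum_Icc_succ_top (by omega),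
      Finset.sum_Icc_succ_top (by omega)]
    have hstep : thetaConst (2 * p + 1 + 1) = thetaConst (2 * p)
        + 4 * (catalanConstant / (2 * (2 * p + 2)) -
          (Real.pi / 4 - (leibnizTail (2 * p + 1) + 1 / (4 * p + 3))) / (4 * (2 * p + 2) ^ 2))
        - 4 * (catalanConstant / (2 * (2 * p + 1)) -
          (Real.pi / 4 + leibnizTail (2 * p + 1)) / (4 * (2 * p + 1) ^ 2))
        + 4 * (1 / (4 * p + 3) - 1 / (4 * p + 5)) := by
      simp only [thetaConst, leibnizTailSum_succ, leibnizTail_succ (2 * p + 1),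
        leibnizTail_succ (2 * p + 1 + 1), pow_succ (-1 : ℝ), hpar]
      push_cast
      rw [show 2 * (2 * (p : ℝ) + 1) + 1 = 4 * p + 3 by ring,
        show 2 * (2 * (p : ℝ) + 1 + 1) + 1 = 4 * p + 5 by ring,
        show 2 * (p : ℝ) + 1 + 1 = 2 * p + 2 by ring]
      ring
    rw [hstep, ih, pow_succ _ (2 * p + 1), pow_succ _ (2 * p), hpar]
    push_cast
    rw [show 2 * (2 * (p : ℝ) + 1) + 1 = 4 * p + 3 by ring,
      show 2 * (2 * (p : ℝ) + 1 + 1) + 1 = 4 * p + 5 by ring,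
      show 4 * ((p : ℝ) + 1) - 1 = 4 * p + 3 by ring,
      show 2 * ((p : ℝ) + 1) - 1 = 2 * p + 1 by ring,
      show 2 * (p : ℝ) + 2 = 2 * (p + 1) by ring]
    field_simp
    ring_nf

theorem thetaConst_odd (p : ℕ) : thetaConst (2 * p + 1) =
    5 - ∑ j ∈ Finset.Icc 1 p, 1 / (4 * (j : ℝ) ^ 2 * (4 * (j : ℝ) + 1))
      + 1 / 4 * ∑ k ∈ Finset.Icc 1 p, ∑ j ∈ Finset.Icc 0 (2 * k),
          (-1 : ℝ) ^ j * (8 * (k : ℝ) ^ 2 + 4 * (k : ℝ) + 1) /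
            ((k : ℝ) ^ 2 * (2 * (j : ℝ) + 1) * (2 * (k : ℝ) + 1) ^ 2)
      + 4 * ∑ j ∈ Finset.Icc 1 (2 * p + 1), (-1 : ℝ) ^ j / (2 * (j : ℝ) + 1)
      + (2 - ∑ j ∈ Finset.Icc 1 p, 1 / ((j : ℝ) * (2 * (j : ℝ) + 1))) * catalanConstant
      + (Real.log 2 ^ 2 / 4 - 3 / 2
          - 1 / 2 * ∑ j ∈ Finset.Icc 1 p, 1 / (2 * (j : ℝ) + 1) ^ 2) * Real.pi
      + Real.pi ^ 3 / 8
      - 4 * (polylog 3 (1 + I)).im := by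
  induction p with
  | zero =>
    simp [thetaConst, leibnizTailSum_succ, leibnizTailSum_zero, leibnizTail_succ, leibnizTail_zero]
    ring
  | succ p ih =>
    have hpar : (-1 : ℝ) ^ (2 * p) = 1 := by simp
    have hpar2 : (-1 : ℝ) ^ (2 * p + 1 + 1) = 1 := by rw [pow_succ, pow_succ, hpar]; norm_num
    -- Here 8k²+4k+1 = (2k+1)² + 4k². The inner sum ends at R_{2p+3}, rewritten through R_{2p+2} so
    -- that a single tail remains.
    have hin : ∑ j ∈ Finset.Icc 0 (2 * (p + 1)),
          (-1 : ℝ) ^ j * (8 * ((p + 1 : ℕ) : ℝ) ^ 2 + 4 * ((p + 1 : ℕ) : ℝ) + 1) /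
            (((p + 1 : ℕ) : ℝ) ^ 2 * (2 * (j : ℝ) + 1) * (2 * ((p + 1 : ℕ) : ℝ) + 1) ^ 2) =
        (1 / ((p : ℝ) + 1) ^ 2 + 4 / (2 * p + 3) ^ 2) *
          (Real.pi / 4 - (leibnizTail (2 * p + 2) - 1 / (4 * p + 5))) := by
      have e : leibnizTail (2 * p + 2) - 1 / (4 * p + 5) = leibnizTail (2 * (p + 1) + 1) := by
        rw [show 2 * (p + 1) + 1 = 2 * p + 1 + 1 + 1 by ring, leibnizTail_succ (2 * p + 1 + 1),
          hpar2]
        push_cast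
        rw [show 2 * (2 * (p : ℝ) + 1 + 1) + 1 = 4 * p + 5 by ring]
      rw [e, ← sum_Icc_leibniz, Finset.mul_sum]
      refine Finset.sum_congr rfl fun j _ => ?_
      push_cast
      rw [show 2 * ((p : ℝ) + 1) + 1 = 2 * p + 3 by ring]
      field_simp
      ring
    rw [Finset.sum_Icc_succ_top (by omega), Finset.sum_Icc_succ_top (by omega),
      Finset.sum_Icc_succ_top (by omega), Finset.sum_Icc_succ_top (by omega), Finset.sum_Icc_succ_top (by omega),
      hin, show 2 * (p + 1) = 2 * p + 1 + 1 by ring, Finset.sum_Icc_succ_top (by omega)]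
    have hstep : thetaConst (2 * p + 1 + 1 + 1) = thetaConst (2 * p + 1)
        - 4 * (catalanConstant / (2 * (2 * p + 2)) -
          (Real.pi / 4 - leibnizTail (2 * p + 2)) / (4 * (2 * p + 2) ^ 2))
        + 4 * (catalanConstant / (2 * (2 * p + 3)) -
          (Real.pi / 4 + (leibnizTail (2 * p + 2) - 1 / (4 * p + 5))) / (4 * (2 * p + 3) ^ 2))
        + 4 * (1 / (4 * p + 5) - 1 / (4 * p + 7)) := by
      simp only [thetaConst, leibnizTailSum_succ, leibnizTail_succ (2 * p + 1 + 1),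
        leibnizTail_succ (2 * p + 1 + 1 + 1), pow_succ (-1 : ℝ), hpar]
      push_cast
      rw [show 2 * (2 * (p : ℝ) + 1 + 1) + 1 = 4 * p + 5 by ring,
        show 2 * (2 * (p : ℝ) + 1 + 1 + 1) + 1 = 4 * p + 7 by ring,
        show 2 * p + 1 + 1 = 2 * p + 2 by ring]
      ring
    rw [hstep, ih, pow_succ _ (2 * p + 1 + 1), hpar2]
    push_cast
    rw [show 2 * (2 * (p : ℝ) + 1 + 1) + 1 = 4 * p + 5 by ring,
      show 2 * (2 * (p : ℝ) + 1 + 1 + 1) + 1 = 4 * p + 7 by ring,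
      show 4 * ((p : ℝ) + 1) + 1 = 4 * p + 5 by ring,
      show 2 * ((p : ℝ) + 1) + 1 = 2 * p + 3 by ring,
      show 2 * (p : ℝ) + 2 = 2 * (p + 1) by ring]
    field_simp
    ring_nf

theorem theorem4 (m n : ℕ) (hm : 1 ≤ m) (hmn : m ≤ n) :
    (n = m →
      HasSum (fun k : ℕ => theta2Term n (2 * m + 1) (k + 1))
        (((-1 : ℝ) ^ m *
          (-4
            - 4 * ∑ k ∈ Finset.Icc 1 m, ∑ j ∈ Finset.Icc 0 k,
                (-1 : ℝ) ^ j / ((2 * (j : ℝ) + 1) * (2 * (k : ℝ) + 1) ^ 2)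
            + (1 - Real.log 2 ^ 2 / 4 + ∑ k ∈ Finset.Icc 1 m, 1 / (2 * (k : ℝ) + 1) ^ 2) * Real.pi
            - Real.pi ^ 3 / 8
            + 4 * (polylog 3 (1 + Complex.I)).im) : ℝ) : ℂ)) ∧
    (n = m + 1 →
      HasSum (fun k : ℕ => theta2Term n (2 * m + 1) (k + 1))
        (((-1 : ℝ) ^ m *
          (11 / 3
            + 4 * ∑ k ∈ Finset.Icc 1 m, ∑ j ∈ Finset.Icc 0 (k + 1),
                (-1 : ℝ) ^ j / ((2 * (j : ℝ) + 1) * (2 * (k : ℝ) + 1) ^ 2)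
            - 3 * Real.pi / 2
            + (Real.log 2 ^ 2 / 4 - ∑ k ∈ Finset.Icc 1 m, 1 / (2 * (k : ℝ) + 1) ^ 2) * Real.pi
            + Real.pi ^ 3 / 8
            + 2 * catalanConstant
            - 4 * (polylog 3 (1 + Complex.I)).im) : ℝ) : ℂ)) ∧
    (Odd (n - m) → n - m ≠ 1 →
      HasSum (fun k : ℕ => theta2Term n (2 * m + 1) (k + 1))
        (((-1 : ℝ) ^ m *
          (5
            - ∑ j ∈ Finset.Icc 1 ((n - m - 1) / 2), 1 / (4 * (j : ℝ) ^ 2 * (4 * (j : ℝ) + 1))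
            - 4 * ∑ k ∈ Finset.Icc 1 m, ∑ j ∈ Finset.Icc 0 (k + (n - m)),
                (-1 : ℝ) ^ (j + (n - m)) / ((2 * (j : ℝ) + 1) * (2 * (k : ℝ) + 1) ^ 2)
            + 1 / 4 * ∑ k ∈ Finset.Icc 1 ((n - m - 1) / 2), ∑ j ∈ Finset.Icc 0 (2 * k),
                (-1 : ℝ) ^ j * (8 * (k : ℝ) ^ 2 + 4 * (k : ℝ) + 1) /
                  ((k : ℝ) ^ 2 * (2 * (j : ℝ) + 1) * (2 * (k : ℝ) + 1) ^ 2)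
            + 4 * ∑ j ∈ Finset.Icc 1 (n - m), (-1 : ℝ) ^ j / (2 * (j : ℝ) + 1)
            + (2 - ∑ j ∈ Finset.Icc 1 ((n - m - 1) / 2), 1 / ((j : ℝ) * (2 * (j : ℝ) + 1))) *
                catalanConstant
            + (Real.log 2 ^ 2 / 4 - 3 / 2
                + (-1 : ℝ) ^ (n - m) * ∑ j ∈ Finset.Icc 1 m, 1 / (2 * (j : ℝ) + 1) ^ 2
                - 1 / 2 * ∑ j ∈ Finset.Icc 1 ((n - m - 1) / 2), 1 / (2 * (j : ℝ) + 1) ^ 2) *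
                Real.pi
            + Real.pi ^ 3 / 8
            - 4 * (polylog 3 (1 + Complex.I)).im) : ℝ) : ℂ)) ∧
    (Even (n - m) →
      HasSum (fun k : ℕ => theta2Term n (2 * m + 1) (k + 1))
        (((-1 : ℝ) ^ m *
          (-4
            + 1 / 4 * ∑ j ∈ Finset.Icc 1 ((n - m) / 2), 1 / ((j : ℝ) ^ 2 * (4 * (j : ℝ) - 1))
            - 4 * ∑ k ∈ Finset.Icc 1 m, ∑ j ∈ Finset.Icc 0 (k + (n - m)),
                (-1 : ℝ) ^ (j + (n - m)) / ((2 * (j : ℝ) + 1) * (2 * (k : ℝ) + 1) ^ 2)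
            - 1 / 4 * ∑ k ∈ Finset.Icc 1 ((n - m) / 2), ∑ j ∈ Finset.Icc 0 (2 * k - 2),
                (-1 : ℝ) ^ j * (8 * (k : ℝ) ^ 2 - 4 * (k : ℝ) + 1) /
                  ((k : ℝ) ^ 2 * (2 * (j : ℝ) + 1) * (2 * (k : ℝ) - 1) ^ 2)
            - 4 * ∑ j ∈ Finset.Icc 1 (n - m), (-1 : ℝ) ^ j / (2 * (j : ℝ) + 1)
            + (1 + (-1 : ℝ) ^ (n - m) * ∑ j ∈ Finset.Icc 1 m, 1 / (2 * (j : ℝ) + 1) ^ 2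
                + 1 / 2 * ∑ j ∈ Finset.Icc 1 ((n - m) / 2), 1 / (2 * (j : ℝ) - 1) ^ 2) * Real.pi
            - Real.pi / 4 * Real.log 2 ^ 2
            - Real.pi ^ 3 / 8
            - catalanConstant *
                ∑ j ∈ Finset.Icc 1 ((n - m) / 2), 1 / ((j : ℝ) * (2 * (j : ℝ) - 1))
            + 4 * (polylog 3 (1 + Complex.I)).im) : ℝ) : ℂ)) := by 
  obtain ⟨d, rfl⟩ := Nat.exists_eq_add_of_le hmn
  have key := hasSum_theta2Term_thetaConst m d
  rw [Nat.add_sub_cancel_left]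
  refine ⟨fun h => ?_, fun h => ?_, fun h _ => ?_, fun h => ?_⟩
  · obtain rfl : d = 0 := by omega
    convert key using 2
    have hc := thetaConst_even 0
    rw [mul_zero] at hc
    rw [hc]
    simp
    ring
  · obtain rfl : d = 1 := by omega
    convert key using 2
    -- The odd formula also holds at d = 1; the single term 4·(-1/3) turns 5 into 11/3.
    have hc := thetaConst_odd 0
    rw [mul_zero, zero_add] at hc
    rw [hc]
    have e : ∀ k j : ℕ, (-1 : ℝ) ^ (j + 1) / ((2 * (j : ℝ) + 1) * (2 * (k : ℝ) + 1) ^ 2) =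
        -((-1 : ℝ) ^ j / ((2 * (j : ℝ) + 1) * (2 * (k : ℝ) + 1) ^ 2)) := by
      intro k j
      rw [pow_succ]
      ring
    simp only [e, Finset.sum_neg_distrib]
    simp
    ring
  · obtain ⟨p, rfl⟩ := h
    convert key using 2
    rw [thetaConst_odd, show (2 * p + 1 - 1) / 2 = p by omega]
    ring
  · obtain ⟨p, rfl⟩ := h.exists_two_nsmul
    rw [smul_eq_mul] at key ⊢
    convert key using 2
    rw [thetaConst_even, show 2 * p / 2 = p by omega]
    ring
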